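/- Fix $\beta\in(0,1)$ and an integer $e_{\max}\ge 1$. Let $V,Y,\gamma$ be positive random variables (packet utility, its observation, channel SNR), where $Y$ has a density and its support is $(0,\infty)$. Let $\gamma_{\mathrm{th}}:\mathbb R\to\mathbb R$ be measurable, and suppose that $W=\chi(\gamma>\gamma_{\mathrm{th}}(Y))\,V$ has finite mean, where $\chi$ denotes the indicator. Let $\bar V(y)=\mathbb E[W\mid Y=y]$. Assume that $\bar V$ is continuous on $[0,\infty)$ and strictly increasing on $(0,\infty)$, with $\bar V(0)=0$ and $\lim_{y\to\infty}\bar V(y)=\infty$. For $x\in[0,1]$ let $y_{\mathrm{th}}(x)\in[0,\infty]$ be the threshold with $\mathbb P(Y\ge y_{\mathrm{th}}(x))=x$, so that $y_{\mathrm{th}}(1)=0$ and $y_{\mathrm{th}}(0)=\infty$. Set $\bar V(\infty)=\infty$ and $g(x)=\mathbb E[W\,\chi(Y\ge y_{\mathrm{th}}(x))]$. The set $\mathcal U$ of admissible policies consists of all $\eta:\{0,\dots,e_{\max}\}\to[0,1]$ with $\eta(0)=0$, $\eta(e_{\max})\in(0,1]$ and $\eta(e)\in(0,1)$ for $0<e<e_{\max}$.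 For $\eta\in\mathcal U$ let $\pi_\eta$ be the steady-state distribution of the battery level $E_{k+1}=\min\{E_k-Q_k+B_k,e_{\max}\}$ where, given $E_k$, the variables $Q_k$ and $B_k$ are independent Bernoulli with success probabilities $\eta(E_k)$ and $\beta$. Put $$G(\eta)=\sum_{e=1}^{e_{\max}}\pi_\eta(e)\,g(\eta(e)),\quad P(\eta)=\sum_{e=1}^{e_{\max}}\pi_\eta(e)\,\eta(e),\quad Z_\lambda(\eta)=G(\eta)-\lambda P(\eta),\quad z_\lambda(x)=g(x)-\lambda x .$$ Then for every $\lambda\ge 0$ the function $Z_\lambda$ has a maximiser $\eta^{(\lambda)}$ over $\mathcal U$, and the following hold. (P1) The maximiser is unique: $Z_\lambda(\eta^{(\lambda)})>Z_\lambda(\eta)$ for all $\eta\in\mathcal U$ with $\eta\ne\eta^{(\lambda)}$. (P2) $\eta^{(\lambda)}$ is continuous in $\lambda\in[0,\infty)$. (P3) For every $\lambda\ge0$, $\eta^{(\lambda)}(e)$ is strictly increasing in $e$, and $\eta^{(\lambda)}(e)\in(\eta_L(\lambda),\eta_U(\lambda))$ for all $e\ne 0$. Here $x^*_\lambda$ is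 the unique maximiser of $z_\lambda$ over $[0,1]$ and also the unique solution $x\in[0,1]$ of $\bar V(y_{\mathrm{th}}(x))=\lambda$. The bound $\eta_L(\lambda)$ is the unique solution $x\in(0,1]$ of $$g(x)+(1-x)\bar V(y_{\mathrm{th}}(x))-\frac{z_\lambda(\min\{x_\lambda^*,\beta\})}{\beta}=\lambda$$ and lies in $(0,\min\{x^*_\lambda,\beta\})$. The bound $\eta_U(\lambda)$ is the unique solution $x\in(0,1]$ of $$g(x)-x\,\bar V(y_{\mathrm{th}}(x))-z_\lambda(\min\{x^*_\lambda,\beta\})=0$$ and lies in $[\min\{\beta,x^*_\lambda\},x^*_\lambda]$. -/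

import Mathlib

open MeasureTheory Set Filter Topology

noncomputable section

namespace EHSensor

/-! ### The data packets

`V` is the utility of a packet, `Y` the observation of it, `Γ` the channel SNR, and
`γth y` the decoding threshold on the SNR when the observation is `y`. -/

variable {Ω : Type*} [MeasurableSpace Ω]

/-- The utility `χ(Γ > γth(Y)) V` that a transmitted packet delivers if there is no collision. -/
def received (V Y Γ : Ω → ℝ) (γth : ℝ → ℝ) : Ω → ℝ :=
  {ω | γth (Y ω) < Γ ω}.indicator V

/-- The standing assumptions on `(V, Y, Γ)`, with `Vbar y = E[χ(Γ > γth(Y)) V | Y = y]`. -/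
structure PacketModel (μ : Measure Ω) (V Y Γ : Ω → ℝ) (γth Vbar : ℝ → ℝ) : Prop where
  measurable_V : Measurable V
  measurable_Y : Measurable Y
  measurable_Γ : Measurable Γ
  measurable_γth : Measurable γth
  V_pos : ∀ᵐ ω ∂μ, 0 < V ω
  Y_pos : ∀ᵐ ω ∂μ, 0 < Y ω
  Γ_pos : ∀ᵐ ω ∂μ, 0 < Γ ω
  /-- `Y` has a probability density. -/
  Y_density : μ.map Y ≪ volume
  /-- The support of `Y` is the whole half line. -/
  Y_support : ∀ a b : ℝ, 0 ≤ a → a < b → 0 < μ {ω | a < Y ω ∧ Y ω < b}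
  integrable_received : Integrable (received V Y Γ γth) μ
  /-- `Vbar` is a version of the conditional expectation of the received utility given `Y`. -/
  Vbar_condExp : (fun ω => Vbar (Y ω)) =ᵐ[μ]
    μ[received V Y Γ γth | MeasurableSpace.comap Y inferInstance]
  Vbar_strictMono : StrictMonoOn Vbar (Ioi 0)
  Vbar_continuous : ContinuousOn Vbar (Ici 0)
  Vbar_zero : Vbar 0 = 0
  Vbar_tendsto : Tendsto Vbar atTop atTop

/-- The threshold `y_th(x)` with `P(Y ≥ y_th(x)) = x`, as an extended real number:
it is `0` for `x = 1` and `∞` for `x = 0` (never transmit). -/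
def threshold (μ : Measure Ω) (Y : Ω → ℝ) (x : ℝ) : EReal :=
  sSup {t : EReal | x ≤ μ.real {ω | t ≤ (Y ω : EReal)}}

/-- The extension of `Vbar` by its limit `Vbar(∞) = ∞`. -/
def VbarExt (Vbar : ℝ → ℝ) (t : EReal) : EReal :=
  if t = ⊤ then ⊤ else (Vbar t.toReal : EReal)

/-- `g(x) = E[χ(Γ > γth(Y)) Q V]` for the decision `Q = χ(Y ≥ y_th(x))`. -/
def g (μ : Measure Ω) (V Y Γ : Ω → ℝ) (γth : ℝ → ℝ) (x : ℝ) : ℝ :=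
  ∫ ω in {ω | threshold μ Y x ≤ (Y ω : EReal)}, received V Y Γ γth ω ∂μ

/-- `z_λ(x) = g(x) - λ x`. -/
def z (μ : Measure Ω) (V Y Γ : Ω → ℝ) (γth : ℝ → ℝ) (lam x : ℝ) : ℝ :=
  g μ V Y Γ γth x - lam * x

/-! ### The battery

The energy level lives in `{0, …, emax}`, represented by `Fin (emax + 1)`. A policy gives the
transmission probability in each energy level. -/

/-- Admissible policies. -/
def Admissible (emax : ℕ) : Set (Fin (emax + 1) → ℝ) :=
  {η | η 0 = 0 ∧ η (Fin.last emax) ∈ Ioc 0 1 ∧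
    ∀ e, e ≠ 0 → e ≠ Fin.last emax → η e ∈ Ioo 0 1}

/-- The Bernoulli distribution on `{0, 1}` with success probability `p`. -/
def bern (p : ℝ) (i : Fin 2) : ℝ := if i = 1 then p else 1 - p

/-- The next energy level `min {e - q + b, emax}` after the transmit action `q` and the energy
arrival `b`. (The case `e = 0`, `q = 1` has probability zero under an admissible policy.) -/
def nextLevel {emax : ℕ} (e : Fin (emax + 1)) (q b : Fin 2) : Fin (emax + 1) :=
  ⟨min ((e : ℕ) - (q : ℕ) + (b : ℕ)) emax, Nat.lt_succ_of_le (min_le_right _ _)⟩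

/-- Transition matrix of the energy level under the policy `η` with energy arrival rate `β`. -/
def transition {emax : ℕ} (β : ℝ) (η : Fin (emax + 1) → ℝ) :
    Matrix (Fin (emax + 1)) (Fin (emax + 1)) ℝ :=
  fun e f => ∑ q : Fin 2, ∑ b : Fin 2,
    bern (η e) q * bern β b * (if nextLevel e q b = f then 1 else 0)

/-- `p` is a steady-state distribution of the energy level. -/
def IsSteadyState {emax : ℕ} (β : ℝ) (η : Fin (emax + 1) → ℝ) (p : Fin (emax + 1) → ℝ) : Prop :=
  (∀ e, 0 ≤ p e) ∧ ∑ e, p e = 1 ∧ Matrix.vecMul p (transition β η) = p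

open Classical in
/-- The steady-state distribution `π_η` of the energy level (it is unique for admissible `η` and
`0 < β < 1`, as the chain is then irreducible). -/
def steadyState {emax : ℕ} (β : ℝ) (η : Fin (emax + 1) → ℝ) : Fin (emax + 1) → ℝ :=
  if h : ∃ p, IsSteadyState β η p then h.choose else 0

/-- `G(η) = ∑_{e = 1}^{emax} π_η(e) g(η(e))`, the average utility without collisions. -/
def G (μ : Measure Ω) (V Y Γ : Ω → ℝ) (γth : ℝ → ℝ) {emax : ℕ} (β : ℝ)
    (η : Fin (emax + 1) → ℝ) : ℝ :=
  ∑ e : Fin emax, steadyState β η e.succ * g μ V Y Γ γth (η e.succ)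

/-- `P(η) = ∑_{e = 1}^{emax} π_η(e) η(e)`, the average transmission probability. -/
def P {emax : ℕ} (β : ℝ) (η : Fin (emax + 1) → ℝ) : ℝ :=
  ∑ e : Fin emax, steadyState β η e.succ * η e.succ

/-- `Z_λ(η) = G(η) - λ P(η)`. -/
def Z (μ : Measure Ω) (V Y Γ : Ω → ℝ) (γth : ℝ → ℝ) {emax : ℕ} (β lam : ℝ)
    (η : Fin (emax + 1) → ℝ) : ℝ :=
  G μ V Y Γ γth β η - lam * P β η

end EHSensor

end

noncomputable section
namespace EHSensor

/-! ### The steady state of the battery -/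

/-! Energy is priced by convex duality. With `v = Vbar(Y)`, put `Φ M = E[(v - M)⁺]` and `X M = P(v ≥
M)`. For `M ≥ 0`, `X M` is the unique maximiser of `g x - M x` on `[0,1]` and `Φ M` is the maximum,
so a probability `x > 0` and its price `M = Vbar(y_th(x))` are interchangeable.
`PacketModel.isDemand` collects the properties of this pair.

Let `d e` be the increment of the relative value from level `e - 1` to level `e`, with `d (N+1) =
0`. The average-reward Bellman equation at a level `e ≠ 0` reads `Z = β d(e+1) + Φ M` with `M = λ +
β d(e+1) + (1-β) d(e)`. In terms of the surplus `Z - β d(e+1)` it is a first-order recursion running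
down from the full battery, where the surplus is `Z`. At the empty battery nothing can be sent, so
the surplus there must be `0`; `exists_surplus_root` finds such a `Z` by shooting.
`surplus_decreasing` shows that prices rise as the battery empties and all exceed `λ ≥ 0`, hence the
policy is strictly increasing.

Averaged over the stationary law of any admissible policy, the increments cancel by detailed balance
(`sum_bellman_eq`). What remains is `g x ≤ Φ M + M x`, strict wherever the policy differs from the
Bellman one; as all levels have positive probability, that policy is the unique maximiser
(`IsBellmanValue.reward_lt`).

The value `Z` is 1-Lipschitz in `λ` because `0 ≤ P ≤ 1`, and the recursion transmits continuity to
the policy. For the bounds, relaxing the battery to the mean constraint `P ≤ β` gives `Z < c` with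
`c = z_λ(min(x*, β))`. In prices, the equations for `η_L` and `η_U` are `Φ M + M = λ + c/β` and `Φ M
= c`, while the Bellman prices satisfy `Φ M + M = λ + Z/β` at level `1` and `Φ M ≤ Z` at every level
`e ≠ 0`. -/

theorem sum_vecMul_transition {N : ℕ} (β : ℝ) (η p : Fin (N + 1) → ℝ) (h : Fin (N + 1) → ℝ) :
    ∑ f, Matrix.vecMul p (transition β η) f * h f =
      ∑ e, p e * ∑ q : Fin 2, ∑ b : Fin 2, bern (η e) q * bern β b * h (nextLevel e q b) := by
  simp only [Matrix.vecMul, dotProduct, transition, Finset.sum_mul]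
  rw [Finset.sum_comm]
  refine Finset.sum_congr rfl fun e _ => ?_
  simp only [Fin.sum_univ_two, mul_add, add_mul, Finset.sum_add_distrib]
  simp [mul_assoc]

/-- Truncated subtraction is harmless: at level `0` transmitting has weight `η 0 = 0`, and for `e ≠
0` transmitting while harvesting returns to `e - 1 + 1 = e`. -/
theorem expected_nextLevel {N : ℕ} (β : ℝ) {η : Fin (N + 1) → ℝ} (h0 : η 0 = 0) (h : ℕ → ℝ)
    (e : Fin (N + 1)) :
    ∑ q : Fin 2, ∑ b : Fin 2, bern (η e) q * bern β b * h (nextLevel e q b) =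
      h e + β * (1 - η e) * (h (min (e + 1) N) - h e) + (1 - β) * η e * (h (e - 1) - h e) := by
  have h1 : min (e : ℕ) N = e := by omega
  have h2 : min ((e : ℕ) - 1) N = e - 1 := by omega
  simp only [Fin.sum_univ_two, bern, nextLevel, Fin.val_zero, Fin.val_one, Nat.sub_zero,
    Nat.add_zero, h1, h2]
  rcases eq_or_ne e 0 with rfl | he
  · simp [h0]; ring
  · have h3 : (e : ℕ) - 1 + 1 = e := by
      have : (e : ℕ) ≠ 0 := fun h => he (Fin.ext h)
      omega
    simp [h1, h3]; ring

/-- The expected increment of `h` along one step, in terms of the probability flows. -/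
theorem sum_vecMul_transition_sub {N : ℕ} (β : ℝ) {η : Fin (N + 1) → ℝ} (p : Fin (N + 1) → ℝ)
    (h0 : η 0 = 0) (h : ℕ → ℝ) :
    ∑ f, (Matrix.vecMul p (transition β η) f - p f) * h f =
      ∑ k : Fin N, (h (k + 1) - h k) *
        (p k.castSucc * (β * (1 - η k.castSucc)) - p k.succ * ((1 - β) * η k.succ)) := by
  have hsub : ∀ f, (Matrix.vecMul p (transition β η) f - p f) * h f =
      Matrix.vecMul p (transition β η) f * h f - p f * h f := fun f => sub_mul _ _ _
  rw [Finset.sum_congr rfl fun f _ => hsub f, Finset.sum_sub_distrib]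
  rw [sum_vecMul_transition β η p (fun f => h f)]
  simp only [expected_nextLevel β h0 h]
  have key : ∀ e : Fin (N + 1),
      p e * (h e + β * (1 - η e) * (h (min (e + 1) N) - h e) + (1 - β) * η e * (h (e - 1) - h e)) =
      p e * h e + p e * (β * (1 - η e)) * (h (min (e + 1) N) - h e) +
        p e * ((1 - β) * η e) * (h (e - 1) - h e) := fun e => by ring
  simp only [key, Finset.sum_add_distrib]
  rw [Fin.sum_univ_castSucc (fun e : Fin (N + 1) =>
    p e * (β * (1 - η e)) * (h (min (e + 1) N) - h e)),
    Fin.sum_univ_succ (fun e : Fin (N + 1) => p e * ((1 - β) * η e) * (h (e - 1) - h e))]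
  have h1 : ∀ k : Fin N, min ((k : ℕ) + 1) N = k + 1 := fun k => by omega
  simp only [Fin.val_castSucc, Fin.val_last, Fin.val_succ, Fin.val_zero, h1]
  have h2 : ∀ k : Fin N, (h (k + 1) - h k) *
        (p k.castSucc * (β * (1 - η k.castSucc)) - p k.succ * ((1 - β) * η k.succ)) =
      p k.castSucc * (β * (1 - η k.castSucc)) * (h (k + 1) - h k) +
        p k.succ * ((1 - β) * η k.succ) * (h k - h (k + 1)) := fun k => by ring
  simp only [h2, Finset.sum_add_distrib]
  simp
  ring

/-- A strictly positive distribution in detailed balance with the battery chain. -/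
structure IsBalanced {N : ℕ} (β : ℝ) (η p : Fin (N + 1) → ℝ) : Prop where
  pos : ∀ e, 0 < p e
  sum_eq_one : ∑ e, p e = 1
  balance : ∀ k : Fin N,
    p k.castSucc * (β * (1 - η k.castSucc)) = p k.succ * ((1 - β) * η k.succ)

theorem admissible_castSucc_lt_one {N : ℕ} {η : Fin (N + 1) → ℝ} (hη : η ∈ Admissible N)
    (k : Fin N) : η k.castSucc < 1 := by
  by_cases h : k.castSucc = 0
  · rw [h, hη.1]; exact one_pos
  · exact (hη.2.2 _ h (Fin.castSucc_lt_last k).ne).2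

theorem admissible_succ_pos {N : ℕ} {η : Fin (N + 1) → ℝ} (hη : η ∈ Admissible N)
    (k : Fin N) : 0 < η k.succ := by
  by_cases h : k.succ = Fin.last N
  · rw [h]; exact hη.2.1.1
  · exact (hη.2.2 _ (Fin.succ_ne_zero k) h).1

theorem admissible_mem_Icc {N : ℕ} {η : Fin (N + 1) → ℝ} (hη : η ∈ Admissible N)
    (e : Fin (N + 1)) : η e ∈ Icc (0 : ℝ) 1 := by
  by_cases h0 : e = 0
  · rw [h0, hη.1]; simp
  by_cases h : e = Fin.last N
  · rw [h]; exact ⟨hη.2.1.1.le, hη.2.1.2⟩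
  · exact Ioo_subset_Icc_self (hη.2.2 _ h0 h)

theorem IsSteadyState.isBalanced {N : ℕ} {β : ℝ} {η p : Fin (N + 1) → ℝ} (hβ : β ∈ Ioo (0 : ℝ) 1)
    (hη : η ∈ Admissible N) (hp : IsSteadyState β η p) : IsBalanced β η p := by
  obtain ⟨hnn, hsum, hst⟩ := hp
  have hbal : ∀ k : Fin N,
      p k.castSucc * (β * (1 - η k.castSucc)) = p k.succ * ((1 - β) * η k.succ) := by
    intro k
    -- The indicator of the levels above `k` increases only across the edge from `k` to `k + 1`, so
    -- stationarity makes the net flow over that edge vanish.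
    have := sum_vecMul_transition_sub β p hη.1 (fun j => if (k : ℕ) < j then 1 else 0)
    rw [hst] at this
    simp only [sub_self, zero_mul, Finset.sum_const_zero] at this
    rw [Finset.sum_eq_single k] at this
    · simp at this; linarith
    · intro j _ hj
      have : (j : ℕ) ≠ k := fun h => hj (Fin.ext h)
      have h3 : ((k : ℕ) < j + 1) ↔ (k : ℕ) < j := by omega
      simp [h3]
    · simp
  have hβ1 : 0 < 1 - β := sub_pos.2 hβ.2
  have hp0 : 0 < p 0 := by
    refine lt_of_le_of_ne (hnn 0) fun h0 => ?_
    have hz : ∀ e, p e = 0 := by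
      intro e
      induction e using Fin.induction with
      | zero => exact h0.symm
      | succ k ih =>
        have := hbal k
        rw [ih, zero_mul] at this
        exact (mul_eq_zero.1 this.symm).resolve_right (mul_pos hβ1 (admissible_succ_pos hη k)).ne'
    simp [hz] at hsum
  refine ⟨fun e => ?_, hsum, hbal⟩
  induction e using Fin.induction with
  | zero => exact hp0
  | succ k ih =>
    refine lt_of_le_of_ne (hnn _) fun h => ?_
    have := hbal k
    rw [← h, zero_mul] at this
    exact (mul_pos ih (mul_pos hβ.1 (sub_pos.2 (admissible_castSucc_lt_one hη k)))).ne' this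

theorem exists_isSteadyState {N : ℕ} {β : ℝ} {η : Fin (N + 1) → ℝ} (hβ : β ∈ Ioo (0 : ℝ) 1)
    (hη : η ∈ Admissible N) : ∃ p, IsSteadyState β η p := by
  have hβ1 : 0 < 1 - β := sub_pos.2 hβ.2
  -- Unnormalised weights, solving detailed balance upwards from `1` at the empty battery.
  let w : Fin (N + 1) → ℝ := fun e => Fin.induction (motive := fun _ => ℝ) 1
    (fun k r => r * (β * (1 - η k.castSucc)) / ((1 - β) * η k.succ)) e
  have hw : ∀ k : Fin N,
      w k.succ = w k.castSucc * (β * (1 - η k.castSucc)) / ((1 - β) * η k.succ) := fun k => by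
    simp only [w, Fin.induction_succ]
  have hpos : ∀ e, 0 < w e := by
    intro e
    induction e using Fin.induction with
    | zero => simp [w]
    | succ k ih =>
      rw [hw]
      exact div_pos (mul_pos ih (mul_pos hβ.1 (sub_pos.2 (admissible_castSucc_lt_one hη k))))
        (mul_pos hβ1 (admissible_succ_pos hη k))
  have hS : 0 < ∑ e, w e := Finset.sum_pos (fun e _ => hpos e) Finset.univ_nonempty
  refine ⟨fun e => w e / ∑ e, w e, fun e => (div_pos (hpos e) hS).le, ?_, ?_⟩
  · rw [← Finset.sum_div, div_self hS.ne']
  · ext f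
    have := sum_vecMul_transition_sub β (fun e => w e / ∑ e, w e) hη.1
      (fun j => if j = (f : ℕ) then 1 else 0)
    rw [Finset.sum_eq_zero (s := (Finset.univ : Finset (Fin N)))] at this
    · rw [Finset.sum_eq_single f] at this
      · simpa [sub_eq_zero] using this
      · intro e _ he
        have : (e : ℕ) ≠ f := fun h => he (Fin.ext h)
        simp [this]
      · simp
    · intro k _
      have := admissible_succ_pos hη k
      rw [hw]
      field_simp
      simp

theorem steadyState_isBalanced {N : ℕ} {β : ℝ} {η : Fin (N + 1) → ℝ} (hβ : β ∈ Ioo (0 : ℝ) 1)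
    (hη : η ∈ Admissible N) : IsBalanced β η (steadyState β η) := by
  have h := exists_isSteadyState hβ hη
  rw [steadyState, dif_pos h]
  exact h.choose_spec.isBalanced hβ hη

/-- Summation of the balance equations against a potential increment `d`. -/
theorem IsBalanced.sum_flow {N : ℕ} {β : ℝ} {η p : Fin (N + 1) → ℝ} (hp : IsBalanced β η p)
    (h0 : η 0 = 0) (d : ℕ → ℝ) :
    ∑ e, p e * (β * (1 - η e) * d (e + 1) - (1 - β) * η e * d e) =
      p (Fin.last N) * (β * (1 - η (Fin.last N)) * d (N + 1)) := by
  rw [Finset.sum_congr rfl fun e _ => mul_sub (p e) _ _, Finset.sum_sub_distrib,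
    Fin.sum_univ_castSucc,
    Fin.sum_univ_succ (fun e : Fin (N + 1) => p e * ((1 - β) * η e * d e))]
  have : ∀ k : Fin N, p k.castSucc * (β * (1 - η k.castSucc) * d ((k.castSucc : ℕ) + 1)) =
      p k.succ * ((1 - β) * η k.succ * d k.succ) := fun k => by
    rw [← mul_assoc, hp.balance k, mul_assoc]; simp
  rw [Finset.sum_congr rfl fun k _ => this k]
  simp [h0]

/-- Energy is not spent faster than it arrives: the gap is the arrivals lost while a full battery
idles. -/
theorem IsBalanced.sum_mul_le {N : ℕ} {β : ℝ} {η p : Fin (N + 1) → ℝ} (hp : IsBalanced β η p)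
    (hβ : 0 ≤ β) (hη : η ∈ Admissible N) : ∑ e, p e * η e ≤ β := by
  have h := hp.sum_flow hη.1 (fun _ => 1)
  have h1 : ∀ e, p e * (β * (1 - η e) * 1 - (1 - β) * η e * 1) = p e * β - p e * η e :=
    fun e => by ring
  simp only [h1, Finset.sum_sub_distrib, ← Finset.sum_mul, hp.sum_eq_one] at h
  have := mul_nonneg (hp.pos (Fin.last N)).le (mul_nonneg hβ (sub_nonneg.2 hη.2.1.2))
  linarith

/-! ### Prices of energy

A utility function `g` on `[0,1]` is described through its conjugate `Φ` and its demand `X`: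
at the price `M` the surplus `g x - M x` has the maximum `Φ M`, attained at `x = X M` only. -/

structure IsDemand (g Φ X : ℝ → ℝ) : Prop where
  g_zero : g 0 = 0
  X_strictAnti : StrictAntiOn X (Ici 0)
  X_continuous : ContinuousOn X (Ici 0)
  X_zero : X 0 = 1
  X_pos : ∀ M, 0 ≤ M → 0 < X M
  X_surj : ∀ x ∈ Ioc (0 : ℝ) 1, ∃ M, 0 ≤ M ∧ X M = x
  Φ_pos : ∀ M, 0 < Φ M
  Φ_strictAnti : StrictAnti Φ
  Φ_continuous : Continuous Φ
  Φ_tendsto : Tendsto Φ atTop (𝓝 0)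
  Φ_of_nonpos : ∀ M ≤ 0, Φ M = Φ 0 - M
  Φ_add_mono : Monotone fun M => Φ M + M
  Φ_add_strictMono : StrictMonoOn (fun M => Φ M + M) (Ici 0)
  g_X : ∀ M, 0 ≤ M → g (X M) = Φ M + M * X M
  g_lt : ∀ x ∈ Icc (0 : ℝ) 1, ∀ M, 0 ≤ M → x ≠ X M → g x < Φ M + M * x

namespace IsDemand

variable {g Φ X : ℝ → ℝ}

theorem X_le_one (h : IsDemand g Φ X) {M : ℝ} (hM : 0 ≤ M) : X M ≤ 1 :=
  h.X_zero ▸ h.X_strictAnti.antitoneOn (mem_Ici.2 le_rfl) hM hM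

theorem X_lt_one (h : IsDemand g Φ X) {M : ℝ} (hM : 0 < M) : X M < 1 :=
  h.X_zero ▸ h.X_strictAnti (mem_Ici.2 le_rfl) hM.le hM

theorem g_le (h : IsDemand g Φ X) {x M : ℝ} (hx : x ∈ Icc (0 : ℝ) 1) (hM : 0 ≤ M) :
    g x ≤ Φ M + M * x := by
  rcases eq_or_ne x (X M) with rfl | hne
  · exact (h.g_X M hM).le
  · exact (h.g_lt x hx M hM hne).le

/-- Negative prices matter: `Φ` is unbounded there, so even trial surpluses above `Φ 0`, which
shooting may produce, have a price. -/
theorem exists_price (h : IsDemand g Φ X) {u : ℝ} (hu : 0 < u) : ∃ M, Φ M = u := by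
  obtain ⟨b, hb⟩ := (h.Φ_tendsto.eventually (gt_mem_nhds hu)).exists
  have ha : u ≤ Φ (min (Φ 0 - u) 0) := by
    rw [h.Φ_of_nonpos _ (min_le_right _ _)]
    linarith [min_le_left (Φ 0 - u) 0]
  exact mem_range_of_exists_le_of_exists_ge h.Φ_continuous ⟨b, hb.le⟩ ⟨_, ha⟩

end IsDemand

/-- The price at which the surplus is `u`. -/
def priceOf (Φ : ℝ → ℝ) (u : ℝ) : ℝ := Function.invFun Φ u

namespace IsDemand

variable {g Φ X : ℝ → ℝ}

theorem Φ_priceOf (h : IsDemand g Φ X) {u : ℝ} (hu : 0 < u) : Φ (priceOf Φ u) = u :=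
  Function.invFun_eq (h.exists_price hu)

theorem lt_priceOf (h : IsDemand g Φ X) {u M : ℝ} (hu : 0 < u) : M < priceOf Φ u ↔ u < Φ M := by
  rw [← h.Φ_strictAnti.lt_iff_gt, h.Φ_priceOf hu]

theorem priceOf_lt (h : IsDemand g Φ X) {u M : ℝ} (hu : 0 < u) : priceOf Φ u < M ↔ Φ M < u := by
  rw [← h.Φ_strictAnti.lt_iff_gt, h.Φ_priceOf hu]

theorem priceOf_strictAntiOn (h : IsDemand g Φ X) : StrictAntiOn (priceOf Φ) (Ioi 0) :=
  fun u hu v hv huv => (h.lt_priceOf hu).2 (by rwa [h.Φ_priceOf hv])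

theorem priceOf_continuousOn (h : IsDemand g Φ X) : ContinuousOn (priceOf Φ) (Ioi 0) := by
  intro u hu
  rw [ContinuousWithinAt, tendsto_order]
  constructor
  · intro a ha
    rw [h.lt_priceOf hu] at ha
    filter_upwards [self_mem_nhdsWithin, mem_nhdsWithin_of_mem_nhds (gt_mem_nhds ha)] with v hv hva
    exact (h.lt_priceOf hv).2 hva
  · intro a ha
    rw [gt_iff_lt, h.priceOf_lt hu] at ha
    filter_upwards [self_mem_nhdsWithin, mem_nhdsWithin_of_mem_nhds (lt_mem_nhds ha)] with v hv hva
    exact (h.priceOf_lt hv).2 hva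

/-- This makes each surplus in the recursion a monotone function of the preceding one, for fixed
`Z`. -/
theorem priceOf_add_antitoneOn (h : IsDemand g Φ X) :
    AntitoneOn (fun u => priceOf Φ u + u) (Ioi 0) := by
  intro u hu v hv huv
  have := h.Φ_add_mono (h.priceOf_strictAntiOn.antitoneOn hu hv huv)
  simp only [h.Φ_priceOf hu, h.Φ_priceOf hv] at this
  simp only
  linarith

theorem priceOf_add_lt (h : IsDemand g Φ X) {u v : ℝ} (hu : 0 < u) (huv : u < v)
    (hv : 0 ≤ priceOf Φ v) : priceOf Φ v + v < priceOf Φ u + u := by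
  have hlt := h.priceOf_strictAntiOn hu (hu.trans huv) huv
  have := h.Φ_add_strictMono hv (hv.trans hlt.le) hlt
  simp only [h.Φ_priceOf hu, h.Φ_priceOf (hu.trans huv)] at this
  linarith

end IsDemand

/-! ### The Bellman recursion -/

/-- For a tentative average reward `Z`, the surplus left at the level `emax - k`
by the Bellman equation, computed downwards from the full battery. -/
def surplus (Φ : ℝ → ℝ) (β lam Z : ℝ) : ℕ → ℝ
  | 0 => Z
  | k + 1 => Z - β / (1 - β) *
      (priceOf Φ (surplus Φ β lam Z k) - lam - Z + surplus Φ β lam Z k)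

section Recursion

variable {g Φ X : ℝ → ℝ} {β lam : ℝ}

theorem surplus_succ (Z : ℝ) (k : ℕ) : surplus Φ β lam Z (k + 1) = Z - β / (1 - β) *
      (priceOf Φ (surplus Φ β lam Z k) - lam - Z + surplus Φ β lam Z k) := rfl

theorem surplus_succ_eq (hβ : β ∈ Ioo (0 : ℝ) 1) (Z : ℝ) (k : ℕ) :
    surplus Φ β lam Z (k + 1) = (Z + β * lam) / (1 - β) - β / (1 - β) *
      (priceOf Φ (surplus Φ β lam Z k) + surplus Φ β lam Z k) := by
  have : 1 - β ≠ 0 := (sub_pos.2 hβ.2).ne'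
  rw [surplus_succ]; field_simp; ring

/-- Induction on `k`. Just to the right of the root `r` for `k`, the surplus is small and positive,
its price is huge, and the next surplus is negative; for large `Z` the next surplus is positive.
Continuity and strict monotonicity on `Ioi r` then give the next root. The point `r` is excluded
because the surplus `0` has no price and `invFun` takes a default value there. -/
theorem exists_surplus_root (h : IsDemand g Φ X) (hβ : β ∈ Ioo (0 : ℝ) 1) (k : ℕ) :
    ∃ r : ℝ, 0 ≤ r ∧ surplus Φ β lam r k = 0 ∧ (∀ j < k, 0 < surplus Φ β lam r j) ∧
      (∀ Z, r < Z → ∀ j ≤ k, 0 < surplus Φ β lam Z j) ∧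
      ContinuousOn (fun Z => surplus Φ β lam Z k) (Ici r) ∧
      StrictMonoOn (fun Z => surplus Φ β lam Z k) (Ici r) := by
  have hβ1 : 0 < 1 - β := sub_pos.2 hβ.2
  have hc : 0 < β / (1 - β) := div_pos hβ.1 hβ1
  induction k with
  | zero =>
    refine ⟨0, le_rfl, rfl, by simp, fun Z hZ j hj => ?_, continuousOn_id, strictMonoOn_id⟩
    rw [Nat.le_zero.1 hj]; exact hZ
  | succ k ih =>
    obtain ⟨r, hr0, hr, -, hpos, hcont, hmono⟩ := ih
    have hcont' : ContinuousOn (fun Z => surplus Φ β lam Z (k + 1)) (Ioi r) := by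
      have h1 : ContinuousOn (fun Z => surplus Φ β lam Z k) (Ioi r) :=
        hcont.mono Ioi_subset_Ici_self
      have h2 : ContinuousOn (fun Z => priceOf Φ (surplus Φ β lam Z k)) (Ioi r) :=
        h.priceOf_continuousOn.comp h1 fun Z hZ => hpos Z hZ k le_rfl
      simp only [surplus_succ]
      fun_prop
    have hmono' : StrictMonoOn (fun Z => surplus Φ β lam Z (k + 1)) (Ioi r) := by
      intro Z hZ Z' hZ' hlt
      simp only [surplus_succ_eq hβ]
      have h1 := h.priceOf_add_antitoneOn (hpos Z hZ k le_rfl) (hpos Z' hZ' k le_rfl)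
        (hmono (mem_Ici.2 (le_of_lt hZ)) (mem_Ici.2 (le_of_lt hZ')) hlt).le
      have h2 := mul_le_mul_of_nonneg_left h1 hc.le
      have h3 : (Z + β * lam) / (1 - β) < (Z' + β * lam) / (1 - β) := by gcongr
      simp only at h2
      linarith
    -- a point where the next surplus is negative
    obtain ⟨a, har, ha⟩ : ∃ a, r < a ∧ surplus Φ β lam a (k + 1) < 0 := by
      -- For `a < r + 1`, a price above `C` makes the subtracted term in the recursion exceed `a`.
      set C := max ((1 - β) / β * (r + 1) + lam + (r + 1)) 0 with hC
      have h1 : ∀ᶠ Z in 𝓝[Ici r] r, surplus Φ β lam Z k < Φ C := by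
        have := hcont r (mem_Ici.2 le_rfl)
        rw [ContinuousWithinAt, hr] at this
        exact this.eventually (gt_mem_nhds (h.Φ_pos C))
      have h2 : ∀ᶠ Z in 𝓝[>] r, Z < r + 1 :=
        mem_nhdsWithin_of_mem_nhds (gt_mem_nhds (lt_add_one r))
      have h1' : ∀ᶠ Z in 𝓝[>] r, surplus Φ β lam Z k < Φ C :=
        nhdsWithin_mono r Ioi_subset_Ici_self h1
      obtain ⟨a, ha1, ha2, har⟩ := (h1'.and (h2.and self_mem_nhdsWithin)).exists
      refine ⟨a, har, ?_⟩
      have hp := hpos a har k le_rfl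
      have h3 := (h.lt_priceOf hp).2 ha1
      have h4 : (1 - β) / β * a < (1 - β) / β * (r + 1) :=
        mul_lt_mul_of_pos_left ha2 (div_pos hβ1 hβ.1)
      have h5 : (1 - β) / β * a <
          priceOf Φ (surplus Φ β lam a k) - lam - a + surplus Φ β lam a k := by
        have := le_max_left ((1 - β) / β * (r + 1) + lam + (r + 1)) 0
        linarith
      have h6 := mul_lt_mul_of_pos_left h5 hc
      have h7 : β / (1 - β) * ((1 - β) / β * a) = a := by
        have := hβ.1.ne'
        field_simp
      rw [surplus_succ]
      linarith
    -- a point where the next surplus is positive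
    obtain ⟨b, hbr, hb⟩ : ∃ b, r < b ∧ 0 < surplus Φ β lam b (k + 1) := by
      -- By antitonicity, `K` bounds the subtracted term at every `Z > a`, so it suffices that `(Z +
      -- β * lam) / (1 - β)` exceed `K`.
      set K := β / (1 - β) * (priceOf Φ (surplus Φ β lam a k) + surplus Φ β lam a k) with hK
      refine ⟨max (a + 1) ((1 - β) * K - β * lam + 1), lt_max_of_lt_left (by linarith), ?_⟩
      set b := max (a + 1) ((1 - β) * K - β * lam + 1) with hb
      have hab : a < b := lt_max_of_lt_left (by linarith)
      have hrb : r < b := har.trans hab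
      rw [surplus_succ_eq hβ]
      have h1 := mul_le_mul_of_nonneg_left (h.priceOf_add_antitoneOn (hpos a har k le_rfl)
        (hpos b hrb k le_rfl)
        (hmono (mem_Ici.2 (le_of_lt har)) (mem_Ici.2 (le_of_lt hrb)) hab).le) hc.le
      simp only at h1
      have h2 : K < (b + β * lam) / (1 - β) := by
        rw [lt_div_iff₀ hβ1]
        have := le_max_right (a + 1) ((1 - β) * K - β * lam + 1)
        linarith
      linarith
    have hab : a < b := by
      by_contra hle
      have := hmono'.monotoneOn hbr har (not_lt.1 hle)
      linarith
    obtain ⟨s, hs, hs0⟩ := intermediate_value_Icc hab.le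
      (hcont'.mono fun Z hZ => lt_of_lt_of_le har hZ.1) ⟨ha.le, hb.le⟩
    have hrs : r < s := lt_of_lt_of_le har hs.1
    refine ⟨s, hr0.trans hrs.le, hs0, fun j hj => hpos s hrs j (Nat.lt_succ_iff.1 hj),
      fun Z hZ j hj => ?_, hcont'.mono fun Z hZ => lt_of_lt_of_le hrs hZ,
      hmono'.mono fun Z hZ => lt_of_lt_of_le hrs hZ⟩
    rcases Nat.lt_or_eq_of_le hj with hj | rfl
    · exact hpos Z (hrs.trans hZ) j (Nat.lt_succ_iff.1 hj)
    · have hlt : surplus Φ β lam s (k + 1) < surplus Φ β lam Z (k + 1) :=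
        hmono' hrs (hrs.trans hZ) hZ
      exact hs0.symm.trans_lt hlt

theorem exists_bellman_value (h : IsDemand g Φ X) (hβ : β ∈ Ioo (0 : ℝ) 1) (lam : ℝ) (N : ℕ) :
    ∃ Z : ℝ, surplus Φ β lam Z N = 0 ∧ ∀ j < N, 0 < surplus Φ β lam Z j := by
  obtain ⟨r, -, h1, h2, -⟩ := exists_surplus_root h hβ (lam := lam) N
  exact ⟨r, h1, h2⟩

/-- The surpluses decrease strictly from the full to the empty battery, and the price at the full
battery exceeds `lam`. -/
theorem surplus_decreasing (h : IsDemand g Φ X) (hβ : β ∈ Ioo (0 : ℝ) 1) (hlam : 0 ≤ lam) {N : ℕ}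
    (hN : 1 ≤ N) {Z : ℝ} (h0 : surplus Φ β lam Z N = 0)
    (hpos : ∀ j < N, 0 < surplus Φ β lam Z j) :
    lam < priceOf Φ Z ∧ ∀ k < N, surplus Φ β lam Z (k + 1) < surplus Φ β lam Z k := by
  have hβ1 : 0 < 1 - β := sub_pos.2 hβ.2
  have hc : 0 < β / (1 - β) := div_pos hβ.1 hβ1
  have hZ : 0 < Z := hpos 0 hN
  have hfirst : surplus Φ β lam Z 1 < surplus Φ β lam Z 0 := by
    by_contra hle
    rw [not_lt] at hle
    -- A first step upwards would propagate by monotonicity of the recursion, keeping all surpluses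
    -- at least `Z > 0`, against the final value `0`.
    have hge : ∀ k < N, surplus Φ β lam Z k ≤ surplus Φ β lam Z (k + 1) ∧
        Z ≤ surplus Φ β lam Z (k + 1) := by
      intro k
      induction k with
      | zero => exact fun _ => ⟨hle, hle⟩
      | succ k ih =>
        intro hk
        have hk' : k < N := (Nat.lt_succ_self k).trans hk
        have h1 := h.priceOf_add_antitoneOn (hpos k hk') (hpos (k + 1) hk) (ih hk').1
        have h2 := mul_le_mul_of_nonneg_left h1 hc.le
        have h3 : surplus Φ β lam Z (k + 1) ≤ surplus Φ β lam Z (k + 1 + 1) := by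
          rw [surplus_succ_eq hβ Z k, surplus_succ_eq hβ Z (k + 1)]
          simp only at h2
          linarith
        exact ⟨h3, (ih hk').2.trans h3⟩
    have := (hge (N - 1) (by omega)).2
    rw [Nat.sub_add_cancel hN, h0] at this
    linarith
  have hprice : lam < priceOf Φ Z := by
    have h1 : Z - β / (1 - β) * (priceOf Φ Z - lam - Z + Z) < Z := hfirst
    by_contra hle
    have := mul_nonpos_of_nonneg_of_nonpos hc.le (sub_nonpos.2 (not_lt.1 hle))
    have h2 : β / (1 - β) * (priceOf Φ Z - lam - Z + Z) = β / (1 - β) * (priceOf Φ Z - lam) := by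
      ring
    linarith
  refine ⟨hprice, fun k hk => ?_⟩
  suffices surplus Φ β lam Z (k + 1) < surplus Φ β lam Z k ∧
      0 ≤ priceOf Φ (surplus Φ β lam Z k) from this.1
  induction k with
  | zero => exact ⟨hfirst, hlam.trans hprice.le⟩
  | succ k ih =>
    obtain ⟨h1, h2⟩ := ih ((Nat.lt_succ_self k).trans hk)
    have h3 := mul_lt_mul_of_pos_left (h.priceOf_add_lt (hpos _ hk) h1 h2) hc
    refine ⟨?_, h2.trans (h.priceOf_strictAntiOn (hpos _ hk)
      (hpos _ ((Nat.lt_succ_self k).trans hk)) h1).le⟩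
    have h4 := surplus_succ_eq (Φ := Φ) (lam := lam) hβ Z k
    have h5 := surplus_succ_eq (Φ := Φ) (lam := lam) hβ Z (k + 1)
    linarith

end Recursion

/-! ### Optimality of the Bellman policy -/

/-- The policy that buys energy at the Bellman prices. -/
def bellmanPolicy (Φ X : ℝ → ℝ) (β lam Z : ℝ) (N : ℕ) (e : Fin (N + 1)) : ℝ :=
  if e = 0 then 0 else X (priceOf Φ (surplus Φ β lam Z (N - e)))

/-- `Z` solves the Bellman equation with average reward `Z`. -/
structure IsBellmanValue (Φ : ℝ → ℝ) (β lam : ℝ) (N : ℕ) (Z : ℝ) : Prop where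
  empty : surplus Φ β lam Z N = 0
  pos : ∀ j < N, 0 < surplus Φ β lam Z j

section Optimality

variable {g Φ X : ℝ → ℝ} {β lam Z : ℝ} {N : ℕ}

theorem IsBellmanValue.lt_price (hZ : IsBellmanValue Φ β lam N Z) (h : IsDemand g Φ X)
    (hβ : β ∈ Ioo (0 : ℝ) 1) (hlam : 0 ≤ lam) (hN : 1 ≤ N) {k : ℕ} (hk : k < N) :
    lam < priceOf Φ (surplus Φ β lam Z k) := by
  obtain ⟨h1, h2⟩ := surplus_decreasing h hβ hlam hN hZ.empty hZ.pos
  induction k with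
  | zero => exact h1
  | succ k ih =>
    have hk' := (Nat.lt_succ_self k).trans hk
    exact (ih hk').trans (h.priceOf_strictAntiOn (hZ.pos _ hk) (hZ.pos _ hk') (h2 k hk'))

theorem IsBellmanValue.surplus_lt (hZ : IsBellmanValue Φ β lam N Z) (h : IsDemand g Φ X)
    (hβ : β ∈ Ioo (0 : ℝ) 1) (hlam : 0 ≤ lam) (hN : 1 ≤ N) {j k : ℕ} (hjk : j < k) (hk : k ≤ N) :
    surplus Φ β lam Z k < surplus Φ β lam Z j := by
  have h2 := (surplus_decreasing h hβ hlam hN hZ.empty hZ.pos).2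
  induction k, hjk using Nat.le_induction with
  | base => exact h2 j hk
  | succ k hjk ih => exact (h2 k hk).trans (ih (Nat.le_of_succ_le hk))

theorem sub_lt_of_ne_zero {e : Fin (N + 1)} (he : e ≠ 0) : N - (e : ℕ) < N := by
  have : (e : ℕ) ≠ 0 := fun h => he (Fin.ext h)
  omega

theorem bellmanPolicy_zero : bellmanPolicy Φ X β lam Z N 0 = 0 := if_pos rfl

theorem bellmanPolicy_of_ne {e : Fin (N + 1)} (he : e ≠ 0) :
    bellmanPolicy Φ X β lam Z N e = X (priceOf Φ (surplus Φ β lam Z (N - e))) := if_neg he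

theorem IsBellmanValue.policy_mem_Ioo (hZ : IsBellmanValue Φ β lam N Z) (h : IsDemand g Φ X)
    (hβ : β ∈ Ioo (0 : ℝ) 1) (hlam : 0 ≤ lam) (hN : 1 ≤ N) {e : Fin (N + 1)} (he : e ≠ 0) :
    bellmanPolicy Φ X β lam Z N e ∈ Ioo (0 : ℝ) 1 := by
  have hM := hlam.trans_lt (hZ.lt_price h hβ hlam hN (sub_lt_of_ne_zero he))
  rw [bellmanPolicy_of_ne he]
  exact ⟨h.X_pos _ hM.le, h.X_lt_one hM⟩

theorem IsBellmanValue.policy_admissible (hZ : IsBellmanValue Φ β lam N Z) (h : IsDemand g Φ X)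
    (hβ : β ∈ Ioo (0 : ℝ) 1) (hlam : 0 ≤ lam) (hN : 1 ≤ N) :
    bellmanPolicy Φ X β lam Z N ∈ Admissible N := by
  have hlast : Fin.last N ≠ 0 := fun h => by
    have := congrArg Fin.val h
    simp at this; omega
  exact ⟨if_pos rfl, Ioo_subset_Ioc_self (hZ.policy_mem_Ioo h hβ hlam hN hlast),
    fun e he _ => hZ.policy_mem_Ioo h hβ hlam hN he⟩

theorem IsBellmanValue.policy_strictMono (hZ : IsBellmanValue Φ β lam N Z) (h : IsDemand g Φ X)
    (hβ : β ∈ Ioo (0 : ℝ) 1) (hlam : 0 ≤ lam) (hN : 1 ≤ N) :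
    StrictMono (bellmanPolicy Φ X β lam Z N) := by
  intro e f hef
  have hf : f ≠ 0 := (lt_of_le_of_lt (Fin.zero_le e) hef).ne'
  by_cases he : e = 0
  · rw [he, bellmanPolicy_zero]
    exact (hZ.policy_mem_Ioo h hβ hlam hN hf).1
  have hef' : (e : ℕ) < f := hef
  have hfN : (f : ℕ) ≤ N := Nat.lt_succ_iff.1 f.2
  rw [bellmanPolicy_of_ne he, bellmanPolicy_of_ne hf]
  have hpe := hZ.lt_price h hβ hlam hN (sub_lt_of_ne_zero he)
  have hpf := hZ.lt_price h hβ hlam hN (sub_lt_of_ne_zero hf)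
  exact h.X_strictAnti (hlam.trans hpf.le) (hlam.trans hpe.le)
    (h.priceOf_strictAntiOn (hZ.pos _ (sub_lt_of_ne_zero he)) (hZ.pos _ (sub_lt_of_ne_zero hf))
      (hZ.surplus_lt h hβ hlam hN (by omega) (Nat.sub_le _ _)))

/-- The increment of the relative value function from the level `e - 1` to the level `e`. -/
def valueIncrement (Φ : ℝ → ℝ) (β lam Z : ℝ) (N e : ℕ) : ℝ :=
  (Z - surplus Φ β lam Z (N + 1 - e)) / β

/-- The recursion says exactly that the price at level `e` is `λ + β d(e+1) + (1-β) d(e)`, where `d`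
is `valueIncrement`, while the surplus is `Z - β d(e+1)`. -/
theorem bellman_identity (hβ : β ∈ Ioo (0 : ℝ) 1) (x : ℝ) {e : ℕ} (he : e ≤ N) :
    surplus Φ β lam Z (N - e) + (priceOf Φ (surplus Φ β lam Z (N - e)) - lam) * x =
      Z - (β * (1 - x) * valueIncrement Φ β lam Z N (e + 1) -
        (1 - β) * x * valueIncrement Φ β lam Z N e) := by
  have h1 : N + 1 - (e + 1) = N - e := by omega
  have h2 : N + 1 - e = (N - e) + 1 := by omega
  have hβ0 := hβ.1.ne'
  have hβ1 := (sub_pos.2 hβ.2).ne'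
  simp only [valueIncrement, h1, h2, surplus_succ]
  field_simp
  ring

variable {p η : Fin (N + 1) → ℝ}

/-- Detailed balance telescopes the drift, and the boundary term vanishes since the surplus at the
full battery is `Z`. At level `0` the price and `d 0` may be meaningless, but they are multiplied by
`η 0 = 0`. -/
theorem sum_bellman_eq (hβ : β ∈ Ioo (0 : ℝ) 1)
    (h0 : η 0 = 0) (hp : IsBalanced β η p) :
    ∑ e, p e * (surplus Φ β lam Z (N - e) +
      (priceOf Φ (surplus Φ β lam Z (N - e)) - lam) * η e) = Z := by
  have h1 := hp.sum_flow h0 (valueIncrement Φ β lam Z N)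
  have h2 : valueIncrement Φ β lam Z N (N + 1) = 0 := by
    simp [valueIncrement, surplus]
  rw [h2, mul_zero, mul_zero] at h1
  have h3 : ∀ e : Fin (N + 1), p e * (surplus Φ β lam Z (N - e) +
      (priceOf Φ (surplus Φ β lam Z (N - e)) - lam) * η e) = p e * Z -
      p e * (β * (1 - η e) * valueIncrement Φ β lam Z N (e + 1) -
        (1 - β) * η e * valueIncrement Φ β lam Z N e) := fun e => by
    rw [bellman_identity hβ _ (Nat.lt_succ_iff.1 e.2), mul_sub]
  rw [Finset.sum_congr rfl fun e _ => h3 e, Finset.sum_sub_distrib, h1, ← Finset.sum_mul,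
    hp.sum_eq_one]
  simp

theorem IsBellmanValue.reward_policy (hZ : IsBellmanValue Φ β lam N Z) (h : IsDemand g Φ X)
    (hβ : β ∈ Ioo (0 : ℝ) 1) (hlam : 0 ≤ lam) (hN : 1 ≤ N)
    (hp : IsBalanced β (bellmanPolicy Φ X β lam Z N) p) :
    ∑ e, p e * (g (bellmanPolicy Φ X β lam Z N e) - lam * bellmanPolicy Φ X β lam Z N e) = Z := by
  refine (Finset.sum_congr rfl fun e _ => ?_).trans
    (sum_bellman_eq (Φ := Φ) (lam := lam) (Z := Z) hβ bellmanPolicy_zero hp)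
  by_cases he : e = 0
  · simp [he, bellmanPolicy_zero, h.g_zero, hZ.empty]
  · have hk := sub_lt_of_ne_zero he
    rw [bellmanPolicy_of_ne he, h.g_X _ (hlam.trans (hZ.lt_price h hβ hlam hN hk).le),
      h.Φ_priceOf (hZ.pos _ hk)]
    ring

theorem IsBellmanValue.reward_lt (hZ : IsBellmanValue Φ β lam N Z) (h : IsDemand g Φ X)
    (hβ : β ∈ Ioo (0 : ℝ) 1) (hlam : 0 ≤ lam) (hN : 1 ≤ N) (hη : η ∈ Admissible N)
    (hp : IsBalanced β η p) (hne : η ≠ bellmanPolicy Φ X β lam Z N) :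
    ∑ e, p e * (g (η e) - lam * η e) < Z := by
  rw [← sum_bellman_eq (Φ := Φ) (lam := lam) (Z := Z) hβ hη.1 hp]
  have hprice : ∀ e : Fin (N + 1), e ≠ 0 → 0 ≤ priceOf Φ (surplus Φ β lam Z (N - e)) :=
    fun e he => hlam.trans (hZ.lt_price h hβ hlam hN (sub_lt_of_ne_zero he)).le
  refine Finset.sum_lt_sum (fun e _ => mul_le_mul_of_nonneg_left ?_ (hp.pos e).le) ?_
  · by_cases he : e = 0
    · simp [he, hη.1, h.g_zero, hZ.empty]
    · have := h.g_le (admissible_mem_Icc hη e) (hprice e he)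
      rw [h.Φ_priceOf (hZ.pos _ (sub_lt_of_ne_zero he))] at this
      linarith
  · obtain ⟨e, he'⟩ := Function.ne_iff.1 hne
    have he : e ≠ 0 := by
      rintro rfl
      exact he' (hη.1.trans bellmanPolicy_zero.symm)
    rw [bellmanPolicy_of_ne he] at he'
    refine ⟨e, Finset.mem_univ _, mul_lt_mul_of_pos_left ?_ (hp.pos e)⟩
    have := h.g_lt _ (admissible_mem_Icc hη e) _ (hprice e he) he'
    rw [h.Φ_priceOf (hZ.pos _ (sub_lt_of_ne_zero he))] at this
    linarith

/-- No policy reaches the reward that is optimal under the average energy constraint alone. -/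
theorem IsBalanced.reward_lt_of_price (hp : IsBalanced β η p) (h : IsDemand g Φ X)
    (hβ : β ∈ Ioo (0 : ℝ) 1) (hlam : 0 ≤ lam) (hη : η ∈ Admissible N) {M : ℝ} (hM : lam ≤ M)
    (hslack : (M - lam) * (β - X M) = 0) :
    ∑ e, p e * (g (η e) - lam * η e) < g (X M) - lam * X M := by
  have hM0 := hlam.trans hM
  -- `M - lam` is a Lagrange multiplier for `P ≤ β`. Strictness comes from the empty battery, which
  -- earns `0` instead of `Φ M > 0`.
  have h1 : ∑ e, p e * (g (η e) - lam * η e) < ∑ e, p e * (Φ M + (M - lam) * η e) := by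
    refine Finset.sum_lt_sum (fun e _ => mul_le_mul_of_nonneg_left ?_ (hp.pos e).le)
      ⟨0, Finset.mem_univ _, mul_lt_mul_of_pos_left ?_ (hp.pos 0)⟩
    · linarith [h.g_le (admissible_mem_Icc hη e) hM0]
    · simpa [hη.1, h.g_zero] using h.Φ_pos M
  have h2 : ∑ e, p e * (Φ M + (M - lam) * η e) = Φ M + (M - lam) * ∑ e, p e * η e := by
    have : ∀ e, p e * (Φ M + (M - lam) * η e) = p e * Φ M + (M - lam) * (p e * η e) :=
      fun e => by ring
    simp only [this, Finset.sum_add_distrib, ← Finset.sum_mul, ← Finset.mul_sum, hp.sum_eq_one,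
      one_mul]
  have h3 := mul_le_mul_of_nonneg_left (hp.sum_mul_le hβ.1.le hη) (sub_nonneg.2 hM)
  rw [h.g_X M hM0]
  linarith

/-- The price at which `min xs β` is bought, where `xs` is bought at the price `lam`. -/
theorem IsDemand.exists_slack_price (h : IsDemand g Φ X) (hβ : β ∈ Ioo (0 : ℝ) 1)
    (hlam : 0 ≤ lam) :
    ∃ M, lam ≤ M ∧ X M = min (X lam) β ∧ (M - lam) * (β - X M) = 0 := by
  rcases le_total (X lam) β with hle | hle
  · exact ⟨lam, le_rfl, (min_eq_left hle).symm, by simp⟩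
  · obtain ⟨M, hM0, hM⟩ := h.X_surj β ⟨hβ.1, hβ.2.le⟩
    exact ⟨M, (h.X_strictAnti.le_iff_ge hM0 hlam).1 (hM ▸ hle), by rw [hM, min_eq_right hle],
      by simp [hM]⟩

/-- The prices that belong to the bounds on the optimal policy. -/
theorem IsDemand.exists_bounds (h : IsDemand g Φ X) (hβ : β ∈ Ioo (0 : ℝ) 1)
    (hlam : 0 ≤ lam) {M c : ℝ} (hM : lam ≤ M)
    (hslack : (M - lam) * (β - X M) = 0) (hc : c = g (X M) - lam * X M) :
    (∃ ML, M < ML ∧ Φ ML + ML = lam + c / β) ∧ (∃ MU ∈ Icc lam M, Φ MU = c) := by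
  have hM0 := hlam.trans hM
  rw [h.g_X M hM0] at hc
  have hXpos := h.X_pos M hM0
  constructor
  · have h1 : lam + c / β = Φ M / β + M := by
      have h2 : c = Φ M + (M - lam) * β := by linarith
      rw [h2, add_div, mul_div_cancel_right₀ _ hβ.1.ne']
      ring
    have h2 : Φ M + M < lam + c / β := by
      rw [h1]
      have : Φ M < Φ M / β := by
        rw [lt_div_iff₀ hβ.1]
        nlinarith [h.Φ_pos M, hβ.2]
      linarith
    have hcont : Continuous fun M => Φ M + M := h.Φ_continuous.add continuous_id
    have h4 : lam + c / β ≤ Φ (max M (lam + c / β)) + max M (lam + c / β) := by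
      linarith [h.Φ_pos (max M (lam + c / β)), le_max_right M (lam + c / β)]
    obtain ⟨ML, hML, hML'⟩ := intermediate_value_Icc (le_max_left M (lam + c / β))
      hcont.continuousOn ⟨h2.le, h4⟩
    refine ⟨ML, lt_of_le_of_ne hML.1 ?_, hML'⟩
    rintro rfl
    exact h2.ne hML'
  · have h1 : Φ M ≤ c := by
      have := mul_nonneg (sub_nonneg.2 hM) hXpos.le
      linarith
    have h2 : c ≤ Φ lam := by
      have := h.g_le (x := X M) ⟨hXpos.le, h.X_le_one hM0⟩ hlam
      rw [h.g_X M hM0] at this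
      linarith
    obtain ⟨MU, hMU, hMU'⟩ := intermediate_value_Icc' hM h.Φ_continuous.continuousOn ⟨h1, h2⟩
    exact ⟨MU, hMU, hMU'⟩

theorem IsBellmanValue.price_lt (hZ : IsBellmanValue Φ β lam N Z) (h : IsDemand g Φ X)
    (hβ : β ∈ Ioo (0 : ℝ) 1) (hlam : 0 ≤ lam) (hN : 1 ≤ N) {c ML : ℝ} (hc : Z < c) (hML0 : 0 ≤ ML)
    (hML : Φ ML + ML = lam + c / β) {k : ℕ} (hk : k < N) :
    priceOf Φ (surplus Φ β lam Z k) < ML := by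
  have h1 : priceOf Φ (surplus Φ β lam Z k) ≤ priceOf Φ (surplus Φ β lam Z (N - 1)) := by
    rcases eq_or_lt_of_le (Nat.le_sub_one_of_lt hk) with rfl | hlt
    · exact le_rfl
    · exact (h.priceOf_strictAntiOn (hZ.pos _ (by omega)) (hZ.pos _ hk)
        (hZ.surplus_lt h hβ hlam hN hlt (by omega))).le
  refine h1.trans_lt ?_
  have hlast : N - 1 < N := by omega
  have hpr := hlam.trans (hZ.lt_price h hβ hlam hN hlast).le
  rw [← h.Φ_add_strictMono.lt_iff_lt hpr hML0]
  rw [hML, h.Φ_priceOf (hZ.pos _ hlast)]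
  have h2 := surplus_succ_eq (Φ := Φ) (lam := lam) hβ Z (N - 1)
  rw [Nat.sub_add_cancel hN, hZ.empty] at h2
  have hβ0 := hβ.1.ne'
  have hβ1 := (sub_pos.2 hβ.2).ne'
  -- The Bellman equation at level `1`, where the highest price occurs.
  have h3 : surplus Φ β lam Z (N - 1) + priceOf Φ (surplus Φ β lam Z (N - 1)) = lam + Z / β := by
    field_simp at h2 ⊢
    linarith
  rw [h3]
  have := div_lt_div_of_pos_right hc hβ.1
  linarith

/-! ### Continuity in the multiplier -/

theorem continuousOn_bellmanPolicy (h : IsDemand g Φ X) (hβ : β ∈ Ioo (0 : ℝ) 1) (hN : 1 ≤ N)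
    {ζ : ℝ → ℝ} (hζ : ContinuousOn ζ (Ici 0))
    (hval : ∀ lam, 0 ≤ lam → IsBellmanValue Φ β lam N (ζ lam)) :
    ContinuousOn (fun lam => bellmanPolicy Φ X β lam (ζ lam) N) (Ici 0) := by
  have hprice : ∀ k < N, ContinuousOn (fun lam => surplus Φ β lam (ζ lam) k) (Ici 0) →
      ContinuousOn (fun lam => priceOf Φ (surplus Φ β lam (ζ lam) k)) (Ici 0) := fun k hk hc =>
    h.priceOf_continuousOn.comp hc fun lam hlam => (hval lam hlam).pos k hk
  have hsur : ∀ k ≤ N, ContinuousOn (fun lam => surplus Φ β lam (ζ lam) k) (Ici 0) := by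
    intro k
    induction k with
    | zero => exact fun _ => hζ
    | succ k ih =>
      intro hk
      have h1 := ih (Nat.le_of_succ_le hk)
      have h2 := hprice k hk h1
      simp only [surplus_succ]
      fun_prop
  rw [continuousOn_pi]
  intro e
  by_cases he : e = 0
  · simp only [bellmanPolicy, if_pos he]
    exact continuousOn_const
  · simp only [bellmanPolicy, if_neg he]
    have hk := sub_lt_of_ne_zero he
    exact h.X_continuous.comp (hprice _ hk (hsur _ hk.le)) fun lam hlam =>
      le_trans (mem_Ici.1 hlam) ((hval lam hlam).lt_price h hβ hlam hN hk).le

theorem abs_bellmanValue_sub_le (h : IsDemand g Φ X) (hβ : β ∈ Ioo (0 : ℝ) 1) (hN : 1 ≤ N)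
    {ζ : ℝ → ℝ} (hval : ∀ lam, 0 ≤ lam → IsBellmanValue Φ β lam N (ζ lam)) {a b : ℝ}
    (ha : 0 ≤ a) (hb : 0 ≤ b) : |ζ a - ζ b| ≤ |a - b| := by
  have key : ∀ a b, 0 ≤ a → 0 ≤ b → ζ a - ζ b ≤ |a - b| := by
    intro a b ha hb
    set η := bellmanPolicy Φ X β a (ζ a) N with hη
    have hadm : η ∈ Admissible N := (hval a ha).policy_admissible h hβ ha hN
    have hp := steadyState_isBalanced hβ hadm
    have h1 := (hval a ha).reward_policy h hβ ha hN hp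
    -- The policy optimal for `a` is merely feasible for `b`.
    have h2 : ∑ e, steadyState β η e * (g (η e) - b * η e) ≤ ζ b := by
      by_cases hne : η = bellmanPolicy Φ X β b (ζ b) N
      · rw [hne] at hp ⊢
        exact ((hval b hb).reward_policy h hβ hb hN hp).le
      · exact ((hval b hb).reward_lt h hβ hb hN hadm hp hne).le
    have h3 : ∑ e, steadyState β η e * (g (η e) - b * η e) =
        ∑ e, steadyState β η e * (g (η e) - a * η e) +
          (a - b) * ∑ e, steadyState β η e * η e := by
      rw [Finset.mul_sum, ← Finset.sum_add_distrib]
      exact Finset.sum_congr rfl fun e _ => by ring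
    have h4 : ∑ e, steadyState β η e * η e ≤ 1 :=
      (hp.sum_mul_le hβ.1.le hadm).trans hβ.2.le
    have h5 : 0 ≤ ∑ e, steadyState β η e * η e :=
      Finset.sum_nonneg fun e _ => mul_nonneg (hp.pos e).le (admissible_mem_Icc hadm e).1
    have h6 : -((a - b) * ∑ e, steadyState β η e * η e) ≤ |a - b| := by
      refine (neg_le_abs _).trans ?_
      rw [abs_mul, abs_of_nonneg h5]
      exact mul_le_of_le_one_right (abs_nonneg _) h4
    linarith
  rw [abs_le']
  refine ⟨key a b ha hb, ?_⟩
  rw [neg_sub, abs_sub_comm]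
  exact key b a hb ha

theorem continuousOn_bellmanValue (h : IsDemand g Φ X) (hβ : β ∈ Ioo (0 : ℝ) 1) (hN : 1 ≤ N)
    {ζ : ℝ → ℝ} (hval : ∀ lam, 0 ≤ lam → IsBellmanValue Φ β lam N (ζ lam)) :
    ContinuousOn ζ (Ici 0) := by
  have : LipschitzOnWith 1 ζ (Ici 0) := LipschitzOnWith.of_dist_le_mul fun a ha b hb => by
    simpa [Real.dist_eq] using abs_bellmanValue_sub_le h hβ hN hval ha hb
  exact this.continuousOn

end Optimality

/-! ### The prices of the packet model -/

/-- The probability that the expected utility is at least `M`. -/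
def demand {Ω : Type*} [MeasurableSpace Ω] (μ : Measure Ω) (v : Ω → ℝ) (M : ℝ) : ℝ :=
  μ.real {ω | M ≤ v ω}

/-- The mean excess of the expected utility over `M`. -/
def meanExcess {Ω : Type*} [MeasurableSpace Ω] (μ : Measure Ω) (v : Ω → ℝ) (M : ℝ) : ℝ :=
  ∫ ω, max (v ω - M) 0 ∂μ

section MeanExcess

variable {Ω : Type*} [MeasurableSpace Ω] {μ : Measure Ω} {v : Ω → ℝ}

theorem meanExcess_nonneg (M : ℝ) : 0 ≤ meanExcess μ v M :=
  integral_nonneg fun _ => le_max_right _ _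

theorem demand_eq_integral (hv : Integrable v μ) (M : ℝ) :
    demand μ v M = ∫ ω, {ω | M ≤ v ω}.indicator (fun _ => (1 : ℝ)) ω ∂μ := by
  have h : NullMeasurableSet {ω | M ≤ v ω} μ :=
    nullMeasurableSet_le aemeasurable_const hv.aemeasurable
  rw [integral_indicator₀ h]
  simp [demand]

variable [IsProbabilityMeasure μ]

theorem integrable_excess (hv : Integrable v μ) (M : ℝ) :
    Integrable (fun ω => max (v ω - M) 0) μ :=
  (hv.sub (integrable_const M)).pos_part

theorem meanExcess_antitone (hv : Integrable v μ) : Antitone (meanExcess μ v) := fun a b hab =>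
  integral_mono (integrable_excess hv b) (integrable_excess hv a) fun ω =>
    max_le_max (by linarith) le_rfl

/-- Writing the sum as `E[max(v, M)]` shows its monotonicity in `M`; with `meanExcess_antitone` this
yields a Lipschitz bound. -/
theorem meanExcess_add (hv : Integrable v μ) (M : ℝ) :
    meanExcess μ v M + M = ∫ ω, max (v ω) M ∂μ := by
  have h1 : ∀ ω, max (v ω) M = max (v ω - M) 0 + M := fun ω => by
    rw [← max_add_add_right]; simp
  simp only [h1]
  rw [integral_add (integrable_excess hv M) (integrable_const M)]
  simp [meanExcess]

theorem meanExcess_add_monotone (hv : Integrable v μ) :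
    Monotone fun M => meanExcess μ v M + M := by
  intro a b hab
  simp only [meanExcess_add hv]
  exact integral_mono (hv.sup (integrable_const a)) (hv.sup (integrable_const b)) fun ω =>
    max_le_max le_rfl hab

theorem meanExcess_continuous (hv : Integrable v μ) : Continuous (meanExcess μ v) := by
  have key : ∀ a b, a ≤ b → |meanExcess μ v a - meanExcess μ v b| ≤ |a - b| := by
    intro a b hab
    have h1 := meanExcess_antitone hv hab
    have h2 := meanExcess_add_monotone hv hab
    simp only at h2
    rw [abs_of_nonneg (by linarith), abs_of_nonpos (by linarith)]
    linarith
  refine (LipschitzWith.of_dist_le_mul (K := 1) fun a b => ?_).continuous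
  simp only [Real.dist_eq, NNReal.coe_one, one_mul]
  rcases le_total a b with h | h
  · exact key a b h
  · rw [abs_sub_comm, abs_sub_comm a]
    exact key b a h

theorem meanExcess_of_nonpos (hv : Integrable v μ) (hpos : ∀ᵐ ω ∂μ, 0 < v ω) {M : ℝ} (hM : M ≤ 0) :
    meanExcess μ v M = meanExcess μ v 0 - M := by
  have h1 := meanExcess_add hv M
  have h2 := meanExcess_add hv 0
  have h3 : ∫ ω, max (v ω) M ∂μ = ∫ ω, max (v ω) 0 ∂μ := integral_congr_ae <| by
    filter_upwards [hpos] with ω hω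
    rw [max_eq_left hω.le, max_eq_left (hM.trans hω.le)]
  linarith

theorem meanExcess_tendsto (hv : Integrable v μ) : Tendsto (meanExcess μ v) atTop (𝓝 0) := by
  have h := tendsto_integral_filter_of_dominated_convergence (μ := μ) (l := atTop)
    (F := fun (M : ℝ) ω => max (v ω - M) 0) (f := fun _ => (0 : ℝ)) (fun ω => |v ω|)
    (Eventually.of_forall fun M => (integrable_excess hv M).aestronglyMeasurable) ?_ hv.abs ?_
  · rw [integral_zero] at h
    exact h
  · filter_upwards [eventually_ge_atTop (0 : ℝ)] with M hM
    refine Eventually.of_forall fun ω => ?_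
    rw [Real.norm_of_nonneg (le_max_right _ _)]
    exact max_le (by linarith [le_abs_self (v ω)]) (abs_nonneg _)
  · refine Eventually.of_forall fun ω => tendsto_const_nhds.congr' ?_
    filter_upwards [eventually_ge_atTop (v ω)] with M hM
    rw [max_eq_right (sub_nonpos.2 hM)]

theorem demand_tendsto_of_ae (hv : Integrable v μ) {l : Filter ℝ} [l.IsCountablyGenerated]
    {S : Set Ω} (hS : NullMeasurableSet S μ) (h : ∀ᵐ ω ∂μ, ∀ᶠ M in l, M ≤ v ω ↔ ω ∈ S) :
    Tendsto (demand μ v) l (𝓝 (μ.real S)) := by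
  have hlim : μ.real S = ∫ ω, S.indicator (fun _ => (1 : ℝ)) ω ∂μ := by
    rw [integral_indicator₀ hS]; simp
  have hfun : demand μ v = fun M => ∫ ω, {ω | M ≤ v ω}.indicator (fun _ => (1 : ℝ)) ω ∂μ :=
    funext (demand_eq_integral hv)
  rw [hfun, hlim]
  refine tendsto_integral_filter_of_dominated_convergence (fun _ => (1 : ℝ))
    (Eventually.of_forall fun M => ?_) (Eventually.of_forall fun M => ?_) (integrable_const _) ?_
  · exact aestronglyMeasurable_const.indicator₀
      (nullMeasurableSet_le aemeasurable_const hv.aemeasurable)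
  · refine Eventually.of_forall fun ω => ?_
    by_cases hω : M ≤ v ω <;> simp [indicator, hω]
  · filter_upwards [h] with ω hω
    refine tendsto_const_nhds.congr' ?_
    filter_upwards [hω] with M hM
    by_cases hω' : ω ∈ S <;> simp [indicator, hM, hω']

theorem demand_tendsto_atTop (hv : Integrable v μ) : Tendsto (demand μ v) atTop (𝓝 0) := by
  have := demand_tendsto_of_ae hv (S := ∅) (l := atTop) MeasurableSet.empty.nullMeasurableSet
    (Eventually.of_forall fun ω => by
      filter_upwards [eventually_gt_atTop (v ω)] with M hM
      simpa using hM)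
  simpa using this

theorem demand_continuousAt (hv : Integrable v μ) {M : ℝ} (h : ∀ᵐ ω ∂μ, v ω ≠ M) :
    ContinuousAt (demand μ v) M := by
  refine demand_tendsto_of_ae hv (nullMeasurableSet_le aemeasurable_const hv.aemeasurable) ?_
  filter_upwards [h] with ω hω
  rcases lt_or_gt_of_ne hω with h1 | h1
  · filter_upwards [lt_mem_nhds h1] with M' hM'
    simp [not_le.2 hM', not_le.2 h1]
  · filter_upwards [gt_mem_nhds h1] with M' hM'
    simp [hM'.le, h1.le]

end MeanExcess

/-! ### The packet model -/

namespace PacketModel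

variable {Ω : Type*} [MeasurableSpace Ω] {μ : Measure Ω} {V Y Γ : Ω → ℝ} {γth Vbar : ℝ → ℝ}

theorem strictMonoOn_Ici (hm : PacketModel μ V Y Γ γth Vbar) : StrictMonoOn Vbar (Ici 0) := by
  intro a ha b hb hab
  rcases eq_or_lt_of_le (mem_Ici.1 ha) with rfl | ha'
  · have h2 : (0 : ℝ) < b / 2 := half_pos hab
    have h1 : Vbar 0 ≤ Vbar (b / 2) := by
      have hc : Tendsto Vbar (𝓝[>] 0) (𝓝 (Vbar 0)) :=
        (hm.Vbar_continuous 0 (mem_Ici.2 le_rfl)).mono_left (nhdsWithin_mono _ Ioi_subset_Ici_self)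
      refine le_of_tendsto hc ?_
      filter_upwards [self_mem_nhdsWithin, mem_nhdsWithin_of_mem_nhds (gt_mem_nhds h2)]
        with t ht ht'
      exact (hm.Vbar_strictMono ht h2 ht').le
    exact h1.trans_lt (hm.Vbar_strictMono h2 hab (half_lt_self hab))
  · exact hm.Vbar_strictMono ha' (ha'.trans hab) hab

theorem exists_level (hm : PacketModel μ V Y Γ γth Vbar) {M : ℝ} (hM : 0 ≤ M) :
    ∃ t, 0 ≤ t ∧ Vbar t = M := by
  obtain ⟨b, hb, hb0⟩ := ((hm.Vbar_tendsto.eventually_ge_atTop M).and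
    (eventually_ge_atTop (0 : ℝ))).exists
  obtain ⟨t, ht, ht'⟩ := intermediate_value_Icc hb0
    (hm.Vbar_continuous.mono Icc_subset_Ici_self) ⟨by rwa [hm.Vbar_zero], hb⟩
  exact ⟨t, ht.1, ht'⟩

theorem Vbar_pos (hm : PacketModel μ V Y Γ γth Vbar) : ∀ᵐ ω ∂μ, 0 < Vbar (Y ω) := by
  filter_upwards [hm.Y_pos] with ω hω
  have := hm.strictMonoOn_Ici (mem_Ici.2 le_rfl) hω.le hω
  rwa [hm.Vbar_zero] at this

theorem integrable_Vbar (hm : PacketModel μ V Y Γ γth Vbar) :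
    Integrable (fun ω => Vbar (Y ω)) μ :=
  integrable_condExp.congr hm.Vbar_condExp.symm

theorem ae_ne (hm : PacketModel μ V Y Γ γth Vbar) (t : ℝ) : ∀ᵐ ω ∂μ, Y ω ≠ t := by
  have h : μ.map Y {t} = 0 := hm.Y_density (by simp)
  rw [Measure.map_apply hm.measurable_Y (measurableSet_singleton t)] at h
  exact measure_eq_zero_iff_ae_notMem.1 h

theorem Vbar_ae_ne (hm : PacketModel μ V Y Γ γth Vbar) {M : ℝ} (hM : 0 ≤ M) :
    ∀ᵐ ω ∂μ, Vbar (Y ω) ≠ M := by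
  obtain ⟨t, ht, rfl⟩ := hm.exists_level hM
  filter_upwards [hm.ae_ne t, hm.Y_pos] with ω h1 h2 h3
  exact h1 (hm.strictMonoOn_Ici.injOn h2.le ht h3)

theorem le_Vbar_iff (hm : PacketModel μ V Y Γ γth Vbar) {t : ℝ} (ht : 0 ≤ t) :
    ∀ᵐ ω ∂μ, Vbar t ≤ Vbar (Y ω) ↔ t ≤ Y ω := by
  filter_upwards [hm.Y_pos] with ω hω
  exact hm.strictMonoOn_Ici.le_iff_le ht hω.le

theorem demand_level (hm : PacketModel μ V Y Γ γth Vbar) {t : ℝ} (ht : 0 ≤ t) :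
    demand μ (fun ω => Vbar (Y ω)) (Vbar t) = μ.real {ω | t ≤ Y ω} := by
  refine measureReal_congr ?_
  filter_upwards [hm.le_Vbar_iff ht] with ω hω
  exact propext hω

theorem threshold_zero (μ : Measure Ω) (Y : Ω → ℝ) : threshold μ Y 0 = ⊤ :=
  top_le_iff.1 (le_sSup measureReal_nonneg)

theorem g_zero : g μ V Y Γ γth 0 = 0 := by
  simp [g, threshold_zero]

variable [IsProbabilityMeasure μ]

theorem tail_lt (hm : PacketModel μ V Y Γ γth Vbar) {s t : ℝ} (hs : 0 ≤ s) (hst : s < t) :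
    μ.real {ω | t ≤ Y ω} < μ.real {ω | s ≤ Y ω} := by
  have hY := hm.measurable_Y
  have h1 : 0 < μ.real {ω | s < Y ω ∧ Y ω < t} :=
    ENNReal.toReal_pos (hm.Y_support s t hs hst).ne' (measure_ne_top _ _)
  have h2 : μ.real ({ω | t ≤ Y ω} ∪ {ω | s < Y ω ∧ Y ω < t}) =
      μ.real {ω | t ≤ Y ω} + μ.real {ω | s < Y ω ∧ Y ω < t} := by
    refine measureReal_union ?_ ?_
    · rw [Set.disjoint_left]
      exact fun ω h h' => not_lt.2 h h'.2
    · exact (measurableSet_lt measurable_const hY).inter (measurableSet_lt hY measurable_const)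
  have h3 : μ.real ({ω | t ≤ Y ω} ∪ {ω | s < Y ω ∧ Y ω < t}) ≤ μ.real {ω | s ≤ Y ω} := by
    refine measureReal_mono ?_
    rintro ω (h | h)
    · exact hst.le.trans h
    · exact h.1.le
  linarith

theorem tail_pos (hm : PacketModel μ V Y Γ γth Vbar) {t : ℝ} (ht : 0 ≤ t) :
    0 < μ.real {ω | t ≤ Y ω} :=
  measureReal_nonneg.trans_lt (hm.tail_lt ht (lt_add_one t))

/-- Full support makes the tail strictly decreasing, so no larger `s` reaches the same probability.
-/
theorem threshold_tail (hm : PacketModel μ V Y Γ γth Vbar) {t : ℝ} (ht : 0 ≤ t) :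
    threshold μ Y (μ.real {ω | t ≤ Y ω}) = t := by
  refine le_antisymm (sSup_le fun s hs => ?_) (le_sSup ?_)
  · by_contra hlt
    rw [not_le] at hlt
    induction s using EReal.rec with
    | bot => simp at hlt
    | top =>
      simp only [mem_ofPred_eq, top_le_iff, EReal.coe_ne_top, ofPred_false, measureReal_empty] at hs
      exact absurd (hm.tail_pos ht) (not_lt.2 hs)
    | coe s =>
      simp only [mem_ofPred_eq, EReal.coe_le_coe_iff] at hs
      exact absurd (hm.tail_lt ht (EReal.coe_lt_coe_iff.1 hlt)) (not_lt.2 hs)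
  · simp

theorem threshold_demand (hm : PacketModel μ V Y Γ γth Vbar) {M : ℝ} (hM : 0 ≤ M) :
    ∃ t : ℝ, threshold μ Y (demand μ (fun ω => Vbar (Y ω)) M) = t ∧ Vbar t = M := by
  obtain ⟨t, ht, rfl⟩ := hm.exists_level hM
  exact ⟨t, by rw [hm.demand_level ht, hm.threshold_tail ht], rfl⟩

/-- The event depends on `Y` only, so the received utility may be replaced by its conditional
expectation. -/
theorem g_tail (hm : PacketModel μ V Y Γ γth Vbar) {t : ℝ} (ht : 0 ≤ t) :
    g μ V Y Γ γth (μ.real {ω | t ≤ Y ω}) = ∫ ω in {ω | t ≤ Y ω}, Vbar (Y ω) ∂μ := by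
  simp only [g, hm.threshold_tail ht, EReal.coe_le_coe_iff]
  have hS : MeasurableSet[MeasurableSpace.comap Y inferInstance] {ω | t ≤ Y ω} :=
    ⟨Ici t, measurableSet_Ici, rfl⟩
  rw [← setIntegral_condExp hm.measurable_Y.comap_le hm.integrable_received hS]
  exact integral_congr_ae (ae_restrict_of_ae hm.Vbar_condExp.symm)

/-- The surplus at the price `M` of buying at the threshold `t`. -/
theorem surplus_tail (hm : PacketModel μ V Y Γ γth Vbar) {t : ℝ} (ht : 0 ≤ t) (M : ℝ) :
    g μ V Y Γ γth (μ.real {ω | t ≤ Y ω}) - M * μ.real {ω | t ≤ Y ω} =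
      ∫ ω, {ω | t ≤ Y ω}.indicator (fun ω => Vbar (Y ω) - M) ω ∂μ := by
  have hS : MeasurableSet {ω | t ≤ Y ω} := measurableSet_le measurable_const hm.measurable_Y
  rw [hm.g_tail ht, integral_indicator hS,
    integral_sub hm.integrable_Vbar.integrableOn (integrable_const M)]
  simp [mul_comm]

theorem surplus_level (hm : PacketModel μ V Y Γ γth Vbar) {t : ℝ} (ht : 0 ≤ t) :
    g μ V Y Γ γth (μ.real {ω | t ≤ Y ω}) - Vbar t * μ.real {ω | t ≤ Y ω} =
      meanExcess μ (fun ω => Vbar (Y ω)) (Vbar t) := by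
  rw [hm.surplus_tail ht]
  refine integral_congr_ae ?_
  filter_upwards [hm.le_Vbar_iff ht] with ω hω
  by_cases h : t ≤ Y ω
  · simp [indicator, h, hω.2 h]
  · simp [indicator, h, (not_le.1 (mt hω.1 h)).le]

/-- A wrong threshold accepts packets worth less than the price, or rejects packets worth more, when
`Y` falls between `s` and `t`; this has positive probability. -/
theorem surplus_lt (hm : PacketModel μ V Y Γ γth Vbar) {s t : ℝ} (hs : 0 ≤ s) (ht : 0 ≤ t)
    (hst : s ≠ t) :
    g μ V Y Γ γth (μ.real {ω | t ≤ Y ω}) - Vbar s * μ.real {ω | t ≤ Y ω} <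
      meanExcess μ (fun ω => Vbar (Y ω)) (Vbar s) := by
  have hS : MeasurableSet {ω | t ≤ Y ω} := measurableSet_le measurable_const hm.measurable_Y
  rw [hm.surplus_tail ht, ← sub_pos, meanExcess]
  have hi : Integrable ({ω | t ≤ Y ω}.indicator fun ω => Vbar (Y ω) - Vbar s) μ :=
    (hm.integrable_Vbar.sub (integrable_const (Vbar s))).indicator hS
  have he := integrable_excess hm.integrable_Vbar (Vbar s)
  rw [← integral_sub he hi]
  have hnn : 0 ≤ᵐ[μ] fun ω => max (Vbar (Y ω) - Vbar s) 0 -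
      {ω | t ≤ Y ω}.indicator (fun ω => Vbar (Y ω) - Vbar s) ω := by
    refine Eventually.of_forall fun ω => ?_
    by_cases h : t ≤ Y ω <;> simp [indicator, h]
  refine (integral_pos_iff_support_of_nonneg_ae hnn (he.sub hi)).2 ?_
  have hpos : 0 < μ {ω | min s t < Y ω ∧ Y ω < max s t} :=
    hm.Y_support _ _ (le_min hs ht) (min_lt_max.2 hst)
  refine hpos.trans_le (measure_mono ?_)
  rintro ω ⟨h1, h2⟩
  rw [Function.mem_support]
  rcases lt_or_gt_of_ne hst with hlt | hlt
  · rw [min_eq_left hlt.le] at h1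
    rw [max_eq_right hlt.le] at h2
    have := hm.strictMonoOn_Ici hs (hs.trans h1.le) h1
    simp [indicator, not_le.2 h2, this.le, sub_eq_zero, this.ne']
  · rw [min_eq_right hlt.le] at h1
    rw [max_eq_left hlt.le] at h2
    have := hm.strictMonoOn_Ici (ht.trans h1.le) hs h2
    simp [indicator, h1.le, this.le, sub_eq_zero, this.ne']

theorem isDemand (hm : PacketModel μ V Y Γ γth Vbar) :
    IsDemand (g μ V Y Γ γth) (meanExcess μ fun ω => Vbar (Y ω))
      (demand μ fun ω => Vbar (Y ω)) := by
  set Φ := meanExcess μ fun ω => Vbar (Y ω) with hΦ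
  set X := demand μ fun ω => Vbar (Y ω) with hX
  have hv := hm.integrable_Vbar
  have hXpos : ∀ M, 0 ≤ M → 0 < X M := by
    intro M hM
    obtain ⟨t, ht, rfl⟩ := hm.exists_level hM
    rw [hX, hm.demand_level ht]
    exact hm.tail_pos ht
  have hXanti : StrictAntiOn X (Ici 0) := by
    intro a ha b hb hab
    obtain ⟨s, hs, rfl⟩ := hm.exists_level (mem_Ici.1 ha)
    obtain ⟨t, ht, rfl⟩ := hm.exists_level (mem_Ici.1 hb)
    rw [hX, hm.demand_level hs, hm.demand_level ht]
    exact hm.tail_lt hs ((hm.strictMonoOn_Ici.lt_iff_lt hs ht).1 hab)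
  have hXcont : ContinuousOn X (Ici 0) := fun M hM =>
    (demand_continuousAt hv (hm.Vbar_ae_ne hM)).continuousWithinAt
  have hX0 : X 0 = 1 := by
    have h1 : {ω | 0 ≤ Vbar (Y ω)} =ᵐ[μ] univ := by
      filter_upwards [hm.Vbar_pos] with ω hω
      exact eq_true hω.le
    rw [hX, demand, measureReal_congr h1]
    simp
  have hXsurj : ∀ x ∈ Ioc (0 : ℝ) 1, ∃ M, 0 ≤ M ∧ X M = x := by
    intro x hx
    obtain ⟨b, hb, hb0⟩ := (((demand_tendsto_atTop hv).eventually (gt_mem_nhds hx.1)).and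
      (eventually_ge_atTop (0 : ℝ))).exists
    obtain ⟨M, hM, hM'⟩ := intermediate_value_Icc' hb0 (hXcont.mono Icc_subset_Ici_self)
      ⟨hb.le, hX0.symm ▸ hx.2⟩
    exact ⟨M, hM.1, hM'⟩
  have hgX : ∀ M, 0 ≤ M → g μ V Y Γ γth (X M) = Φ M + M * X M := by
    intro M hM
    obtain ⟨t, ht, rfl⟩ := hm.exists_level hM
    have := hm.surplus_level ht
    rw [hX, hm.demand_level ht, hΦ]
    linarith
  have hlt : ∀ M M', 0 ≤ M → 0 ≤ M' → M ≠ M' → g μ V Y Γ γth (X M') < Φ M + M * X M' := by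
    intro M M' hM hM' hne
    obtain ⟨s, hs, rfl⟩ := hm.exists_level hM
    obtain ⟨t, ht, rfl⟩ := hm.exists_level hM'
    have := hm.surplus_lt hs ht (fun h => hne (by rw [h]))
    rw [hX, hm.demand_level ht, hΦ]
    linarith
  -- A strict subgradient inequality. Used in the two orders of `M` and `M'`, it gives strict
  -- monotonicity of `Φ M` and of `Φ M + M`.
  have hsub : ∀ M M', 0 ≤ M → 0 ≤ M' → M ≠ M' → Φ M' + (M' - M) * X M' < Φ M := by
    intro M M' hM hM' hne
    have h1 := hlt M M' hM hM' hne
    rw [hgX M' hM'] at h1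
    linarith
  have hneg : ∀ M ≤ 0, Φ M = Φ 0 - M := fun M hM => meanExcess_of_nonpos hv hm.Vbar_pos hM
  have hΦanti : StrictAnti Φ := by
    refine StrictAntiOn.Iic_union_Ici (a := 0) (fun a ha b hb hab => ?_) fun a ha b hb hab => ?_
    · rw [hneg a ha, hneg b hb]; linarith
    · have := hsub a b ha hb hab.ne
      have h2 := mul_pos (sub_pos.2 hab) (hXpos b hb)
      linarith
  have hΦpos : ∀ M, 0 < Φ M := fun M =>
    (meanExcess_nonneg (M + 1)).trans_lt (hΦanti (lt_add_one M))
  have hΦadd : StrictMonoOn (fun M => Φ M + M) (Ici 0) := by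
    intro a ha b hb hab
    have h1 := hsub b a hb ha hab.ne'
    have h2 : X a ≤ 1 := by
      rw [← hX0]
      exact hXanti.antitoneOn (mem_Ici.2 le_rfl) ha ha
    have h3 := mul_le_mul_of_nonneg_left h2 (sub_nonneg.2 hab.le)
    simp only
    linarith
  refine ⟨g_zero, hXanti, hXcont, hX0, hXpos, hXsurj, hΦpos, hΦanti, meanExcess_continuous hv,
    meanExcess_tendsto hv, hneg, meanExcess_add_monotone hv, hΦadd, hgX, fun x hx M hM hne => ?_⟩
  rcases eq_or_lt_of_le hx.1 with rfl | hx0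
  · rw [g_zero, mul_zero, add_zero]
    exact hΦpos M
  · obtain ⟨M', hM', rfl⟩ := hXsurj x ⟨hx0, hx.2⟩
    exact hlt M M' hM hM' fun h => hne (by rw [h])

end PacketModel

/-! ### Assembly of the theorem -/

theorem Z_eq_sum {Ω : Type*} [MeasurableSpace Ω] (μ : Measure Ω) (V Y Γ : Ω → ℝ) (γth : ℝ → ℝ)
    {N : ℕ} (β lam : ℝ) {η : Fin (N + 1) → ℝ} (h0 : η 0 = 0) :
    Z μ V Y Γ γth β lam η =
      ∑ e, steadyState β η e * (g μ V Y Γ γth (η e) - lam * η e) := by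
  have hg : g μ V Y Γ γth 0 = 0 := PacketModel.g_zero
  rw [Fin.sum_univ_succ, h0, hg, Z, G, P, Finset.mul_sum, ← Finset.sum_sub_distrib]
  simp only [mul_zero, sub_zero, zero_add]
  exact Finset.sum_congr rfl fun e _ => by ring

end EHSensor
end

theorem theorem1 {Ω : Type*} [MeasurableSpace Ω] (μ : Measure Ω) [IsProbabilityMeasure μ]
    (V Y Γ : Ω → ℝ) (γth Vbar : ℝ → ℝ) (hmodel : EHSensor.PacketModel μ V Y Γ γth Vbar)
    (emax : ℕ) (hemax : 1 ≤ emax) (β : ℝ) (hβ : β ∈ Ioo (0 : ℝ) 1) :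
    ∃ ηopt : ℝ → Fin (emax + 1) → ℝ,
      -- P1: for each multiplier there is a maximiser and it is the only one
      (∀ lam : ℝ, 0 ≤ lam →
        ηopt lam ∈ EHSensor.Admissible emax ∧
        ∀ η ∈ EHSensor.Admissible emax, η ≠ ηopt lam →
          EHSensor.Z μ V Y Γ γth β lam η < EHSensor.Z μ V Y Γ γth β lam (ηopt lam)) ∧
      -- P2: continuity in the multiplier
      ContinuousOn ηopt (Ici 0) ∧
      -- P3: monotonicity in the energy level, and the bounds
      (∀ lam : ℝ, 0 ≤ lam →
        StrictMono (ηopt lam) ∧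
        ∃ xs ηL ηU : ℝ,
          -- the unconstrained maximiser of z_λ on [0,1]
          (xs ∈ Icc (0 : ℝ) 1 ∧
            (∀ x ∈ Icc (0 : ℝ) 1, x ≠ xs →
              EHSensor.z μ V Y Γ γth lam x < EHSensor.z μ V Y Γ γth lam xs) ∧
            (∀ x ∈ Icc (0 : ℝ) 1,
              EHSensor.VbarExt Vbar (EHSensor.threshold μ Y x) = (lam : EReal) ↔ x = xs)) ∧
          -- the lower bound
          (ηL ∈ Ioo 0 (min xs β) ∧
            (∀ x ∈ Ioc (0 : ℝ) 1,
              EHSensor.g μ V Y Γ γth x + (1 - x) * Vbar (EHSensor.threshold μ Y x).toReal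
                - EHSensor.z μ V Y Γ γth lam (min xs β) / β = lam ↔ x = ηL)) ∧
          -- the upper bound
          (ηU ∈ Icc (min β xs) xs ∧
            (∀ x ∈ Ioc (0 : ℝ) 1,
              EHSensor.g μ V Y Γ γth x - x * Vbar (EHSensor.threshold μ Y x).toReal
                - EHSensor.z μ V Y Γ γth lam (min xs β) = 0 ↔ x = ηU)) ∧
          ∀ e : Fin (emax + 1), e ≠ 0 → ηopt lam e ∈ Ioo ηL ηU) := by
  open EHSensor in
  have h := hmodel.isDemand
  set Φ := meanExcess μ fun ω => Vbar (Y ω)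
  set X := demand μ fun ω => Vbar (Y ω)
  have hex : ∀ lam : ℝ, ∃ Z, IsBellmanValue Φ β lam emax Z := fun lam => by
    obtain ⟨Z, h1, h2⟩ := exists_bellman_value h hβ lam emax
    exact ⟨Z, h1, h2⟩
  choose ζ hζ using hex
  have hζc := continuousOn_bellmanValue h hβ hemax fun lam _ => hζ lam
  have hZopt : ∀ lam, 0 ≤ lam →
      Z μ V Y Γ γth β lam (bellmanPolicy Φ X β lam (ζ lam) emax) = ζ lam := fun lam hlam => by
    rw [Z_eq_sum μ V Y Γ γth β lam bellmanPolicy_zero]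
    exact (hζ lam).reward_policy h hβ hlam hemax
      (steadyState_isBalanced hβ ((hζ lam).policy_admissible h hβ hlam hemax))
  refine ⟨fun lam => bellmanPolicy Φ X β lam (ζ lam) emax, fun lam hlam => ⟨?_, ?_⟩,
    continuousOn_bellmanPolicy h hβ hemax hζc fun lam _ => hζ lam, fun lam hlam => ⟨?_, ?_⟩⟩
  · exact (hζ lam).policy_admissible h hβ hlam hemax
  · intro η hη hne
    rw [hZopt lam hlam, Z_eq_sum μ V Y Γ γth β lam hη.1]
    exact (hζ lam).reward_lt h hβ hlam hemax hη (steadyState_isBalanced hβ hη) hne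
  · exact (hζ lam).policy_strictMono h hβ hlam hemax
  obtain ⟨M, hM, hXM, hslack⟩ := h.exists_slack_price hβ hlam
  have hM0 := hlam.trans hM
  set c := z μ V Y Γ γth lam (min (X lam) β) with hc
  have hc' : c = g μ V Y Γ γth (X M) - lam * X M := by rw [hc, ← hXM, z]
  obtain ⟨⟨ML, hML, hML'⟩, MU, hMU, hMU'⟩ := h.exists_bounds hβ hlam hM hslack hc'
  have hML0 := hM0.trans hML.le
  have hMU0 := hlam.trans hMU.1
  have hval : ζ lam < c := by
    have hadm := (hζ lam).policy_admissible h hβ hlam hemax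
    have hp := steadyState_isBalanced hβ hadm
    have := hp.reward_lt_of_price h hβ hlam hadm hM hslack
    rwa [(hζ lam).reward_policy h hβ hlam hemax hp, ← hc'] at this
  -- Thresholds of positive probabilities are finite, so `toReal` loses nothing.
  have hVbar : ∀ M, 0 ≤ M → Vbar (threshold μ Y (X M)).toReal = M := by
    intro M hM
    obtain ⟨t, ht, htM⟩ := hmodel.threshold_demand hM
    rw [ht, EReal.toReal_coe, htM]
  refine ⟨X lam, X ML, X MU, ⟨⟨(h.X_pos lam hlam).le, h.X_le_one hlam⟩, ?_, ?_⟩,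
    ⟨⟨h.X_pos ML hML0, ?_⟩, ?_⟩, ⟨⟨?_, ?_⟩, ?_⟩, ?_⟩
  · intro x hx hne
    have h1 := h.g_lt x hx lam hlam hne
    have h2 := h.g_X lam hlam
    simp only [z]
    linarith
  · intro x hx
    rcases eq_or_lt_of_le hx.1 with rfl | hx0
    · simp [PacketModel.threshold_zero, VbarExt, (h.X_pos lam hlam).ne]
    · obtain ⟨m, hm, rfl⟩ := h.X_surj x ⟨hx0, hx.2⟩
      obtain ⟨t, ht, htm⟩ := hmodel.threshold_demand hm
      rw [h.X_strictAnti.injOn.eq_iff hm hlam, ht, VbarExt, if_neg (EReal.coe_ne_top t),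
        EReal.toReal_coe, htm, EReal.coe_eq_coe_iff]
  · rw [← hXM]
    exact h.X_strictAnti hM0 hML0 hML
  · intro x hx
    obtain ⟨m, hm, rfl⟩ := h.X_surj x hx
    rw [h.X_strictAnti.injOn.eq_iff hm hML0, hVbar m hm, h.g_X m hm,
      ← h.Φ_add_strictMono.injOn.eq_iff hm hML0, hML']
    constructor <;> intro h1 <;> linarith
  · rw [min_comm, ← hXM]
    exact h.X_strictAnti.antitoneOn hMU0 hM0 hMU.2
  · exact h.X_strictAnti.antitoneOn hlam hMU0 hMU.1
  · intro x hx
    obtain ⟨m, hm, rfl⟩ := h.X_surj x hx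
    rw [h.X_strictAnti.injOn.eq_iff hm hMU0, hVbar m hm, h.g_X m hm,
      ← h.Φ_strictAnti.injective.eq_iff (a := m), hMU']
    constructor <;> intro h1 <;> linarith
  · intro e he
    have hk := sub_lt_of_ne_zero he
    have hpos := (hζ lam).pos _ hk
    have hpr := hlam.trans ((hζ lam).lt_price h hβ hlam hemax hk).le
    simp only
    rw [bellmanPolicy_of_ne he]
    refine ⟨h.X_strictAnti hpr hML0 ((hζ lam).price_lt h hβ hlam hemax hval hML0 hML' hk),
      h.X_strictAnti hMU0 hpr ((h.lt_priceOf hpos).2 ?_)⟩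
    rw [hMU']
    refine lt_of_le_of_lt ?_ hval
    rcases Nat.eq_zero_or_pos (emax - (e : ℕ)) with h0 | h0
    · rw [h0]; exact le_rfl
    · exact ((hζ lam).surplus_lt h hβ hlam hemax h0 (Nat.sub_le _ _)).le
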